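/- For $k\ge 1$ let $M_k(\mathbb C)$ be the algebra of complex $k\times k$ matrices with the Hilbert--Schmidt inner product $\langle B,C\rangle=\mathrm{Tr}\,B^*C$. For positive semidefinite $\rho_1,\rho_2\in M_k(\mathbb C)$ let $\Delta(\rho_1/\rho_2)$ be the positive linear operator on $M_k(\mathbb C)$ given by $\Delta(\rho_1/\rho_2)B=\rho_1B\rho_2^{-1}$, where $\rho_2^{-1}$ is the inverse of $\rho_2$ (if $\rho_2$ is singular, its inverse on its support, extended by $0$ on its kernel). For $f:[0,\infty)\to\mathbb R$ and $A\in M_k(\mathbb C)$ the quasi-entropy is $$S^A_f(\rho_1\|\rho_2)=\big\langle A\rho_2^{1/2},\,f(\Delta(\rho_1/\rho_2))(A\rho_2^{1/2})\big\rangle .$$ A function $f:[0,\infty)\to\mathbb R$ is operator monotone if $0\le X\le Y$ implies $f(X)\le f(Y)$ for complex matrices $X,Y$ of every size. **Theorem.** Let $f:[0,\infty)\to\mathbb R$ be operator monotone with $f(0)\ge 0$. Let $\alpha:M_m(\mathbb C)\to M_n(\mathbb C)$ be a unital Schwarz mapping, i.e. a linear map with $\alpha(I)=I$ and $\alpha(B)^*\alpha(B)\le\alpha(B^*B)$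 for all $B\in M_m(\mathbb C)$, and let $\alpha^*:M_n(\mathbb C)\to M_m(\mathbb C)$ be its dual with respect to the Hilbert--Schmidt inner products. Then $$S^A_f(\alpha^*(\rho_1)\|\alpha^*(\rho_2))\ \ge\ S^{\alpha(A)}_f(\rho_1\|\rho_2)$$ for every $A\in M_m(\mathbb C)$ and all invertible density matrices (positive definite, trace one) $\rho_1,\rho_2\in M_n(\mathbb C)$. -/

import Mathlib

open scoped MatrixOrder ComplexOrder

noncomputable section

/-- `f : [0, ∞) → ℝ` is operator monotone: `0 ≤ A ≤ B` implies `f(A) ≤ f(B)` for complex matrices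
of every size. Only the values of `f` on `[0, ∞)` matter. -/
def OperatorMonotone (f : ℝ → ℝ) : Prop :=
  ∀ (k : ℕ) (A B : Matrix (Fin k) (Fin k) ℂ), 0 ≤ A → A ≤ B → cfc f A ≤ cfc f B

/-- Schwarz mappings between matrix algebras: `α(B)^* α(B) ≤ α(B^* B)` for every `B`. Such a map
is positive, hence `α(B^*) = α(B)^*`, see `IsSchwarzMap.map_conjTranspose`. -/
def IsSchwarzMap {m n : Type*} [Fintype m] [Fintype n]
    (α : Matrix m m ℂ →ₗ[ℂ] Matrix n n ℂ) : Prop :=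
  ∀ B : Matrix m m ℂ, (α B).conjTranspose * α B ≤ α (B.conjTranspose * B)

theorem IsSchwarzMap.map_conjTranspose {m n : Type*} [Fintype m] [DecidableEq m] [Fintype n]
    {α : Matrix m m ℂ →ₗ[ℂ] Matrix n n ℂ} (hα : IsSchwarzMap α) (B : Matrix m m ℂ) :
    α B.conjTranspose = (α B).conjTranspose := by
  have h (C : Matrix m m ℂ) : (α (C.conjTranspose * C)).IsHermitian := by
    have h1 := Matrix.le_iff.1 (hα C)
    have h2 := h1.isHermitian.add (Matrix.isHermitian_conjTranspose_mul_self (α C))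
    rwa [sub_add_cancel] at h2
  have e1 := (h (1 + B)).eq
  have e2 := (h (1 + Complex.I • B)).eq
  have e0 := (h B).eq
  have e3 := (h 1).eq
  simp only [Matrix.conjTranspose_add, Matrix.conjTranspose_one, Matrix.conjTranspose_smul,
    Matrix.add_mul, Matrix.mul_add, Matrix.one_mul, Matrix.mul_one, map_add, map_smul,
    Matrix.smul_mul, Matrix.mul_smul] at e0 e1 e2 e3
  ext i j
  have a0 := congrFun (congrFun e0 i) j
  have a1 := congrFun (congrFun e1 i) j
  have a2 := congrFun (congrFun e2 i) j
  have a3 := congrFun (congrFun e3 i) j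
  simp only [Matrix.add_apply, Matrix.conjTranspose_apply, Matrix.smul_apply, smul_eq_mul,
    RCLike.star_def, Complex.conj_I, map_neg] at a0 a1 a2 a3 ⊢
  rw [a3, a0] at a1 a2
  linear_combination (-1 / 2 : ℂ) * a1 - (Complex.I / 2) * a2 + (1 / 2 : ℂ) *
    ((starRingEnd ℂ) (α B.conjTranspose j i) - (starRingEnd ℂ) (α B j i)
      + α B.conjTranspose i j - α B i j) * Complex.I_mul_I

/-- The Hilbert-Schmidt inner product `⟨B, C⟩ = Tr B^* C`. -/
def hsInner {n : Type*} [Fintype n] (B C : Matrix n n ℂ) : ℂ :=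
  (B.conjTranspose * C).trace

/-- The dual `α^*` of `α` with respect to the Hilbert-Schmidt inner products, given by its
entries `⟨E i j, α^* Y⟩ = ⟨α (E i j), Y⟩`, where the `E i j` are the matrix units. -/
def hsDual {m n : Type*} [Fintype m] [DecidableEq m] [Fintype n]
    (α : Matrix m m ℂ →ₗ[ℂ] Matrix n n ℂ) : Matrix n n ℂ →ₗ[ℂ] Matrix m m ℂ where
  toFun Y := Matrix.of fun i j => hsInner (α (Matrix.single i j 1)) Y
  map_add' Y Z := by
    ext i j
    simp [hsInner, Matrix.mul_add]
  map_smul' c Y := by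
    ext i j
    simp [hsInner]

/-- `α^*` is the adjoint of `α`. -/
theorem hsInner_hsDual {m n : Type*} [Fintype m] [DecidableEq m] [Fintype n]
    (α : Matrix m m ℂ →ₗ[ℂ] Matrix n n ℂ) (X : Matrix m m ℂ) (Y : Matrix n n ℂ) :
    hsInner X (hsDual α Y) = hsInner (α X) Y := by
  have h : α X = ∑ i, ∑ j, X i j • α (Matrix.single i j 1) := by
    conv_lhs => rw [Matrix.matrix_eq_sum_single X]
    simp only [map_sum]
    refine Finset.sum_congr rfl fun i _ => Finset.sum_congr rfl fun j _ => ?_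
    rw [← map_smul, Matrix.smul_single, smul_eq_mul, mul_one]
  rw [h]
  simp only [hsInner, hsDual, LinearMap.coe_mk, AddHom.coe_mk, Matrix.conjTranspose_sum,
    Matrix.conjTranspose_smul, Matrix.sum_mul, Matrix.trace_sum, Matrix.smul_mul,
    Matrix.trace_smul, smul_eq_mul]
  rw [Finset.sum_comm]
  simp [Matrix.trace, Matrix.mul_apply]

/-- The inverse of a positive semidefinite matrix on its support (and `0` on its kernel). For a
positive definite matrix it is the inverse, see `supportInv_eq_inv`. -/
def supportInv {n : Type*} [Fintype n] [DecidableEq n] (ρ : Matrix n n ℂ) : Matrix n n ℂ :=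
  cfc (fun x : ℝ => x⁻¹) ρ

theorem supportInv_eq_inv {n : Type*} [Fintype n] [DecidableEq n] {ρ : Matrix n n ℂ}
    (hρ : ρ.PosDef) : supportInv ρ = ρ⁻¹ := by
  have hu : IsUnit ρ := hρ.isUnit
  have hs : IsSelfAdjoint ρ := hρ.isHermitian
  have h : cfc (fun x : ℝ => x * x⁻¹) ρ = 1 := by
    rw [← cfc_one ℝ ρ]
    refine cfc_congr fun x hx => ?_
    have : x ≠ 0 := by
      rintro rfl
      exact spectrum.zero_notMem ℝ hu hx
    simp [this]
  rw [cfc_mul (fun x : ℝ => x) (fun x : ℝ => x⁻¹) ρ continuousOn_id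
    (Matrix.finite_real_spectrum.continuousOn _), cfc_id' ℝ ρ] at h
  exact (Matrix.inv_eq_right_inv h).symm

/-- The relative modular operator `Δ(ρ₁/ρ₂) B = ρ₁ B ρ₂⁻¹`. -/
def relModular {n : Type*} [Fintype n] [DecidableEq n] (ρ₁ ρ₂ : Matrix n n ℂ) :
    Matrix n n ℂ →ₗ[ℂ] Matrix n n ℂ :=
  LinearMap.mulLeft ℂ ρ₁ ∘ₗ LinearMap.mulRight ℂ (supportInv ρ₂)

/-- The functional calculus `f(T)` of a linear map `T` on matrices that is self-adjoint for the
Hilbert-Schmidt inner product, computed in the orthonormal basis of the matrix units. -/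
def hsFunctionalCalculus {n : Type*} [Fintype n] [DecidableEq n] (f : ℝ → ℝ)
    (T : Matrix n n ℂ →ₗ[ℂ] Matrix n n ℂ) : Matrix n n ℂ →ₗ[ℂ] Matrix n n ℂ :=
  Matrix.toLin (Matrix.stdBasis ℂ n n) (Matrix.stdBasis ℂ n n)
    (cfc f (LinearMap.toMatrix (Matrix.stdBasis ℂ n n) (Matrix.stdBasis ℂ n n) T))

/-- The quasi-entropy `⟨A ρ₂^{1/2}, f(Δ(ρ₁/ρ₂)) (A ρ₂^{1/2})⟩`. -/
def quasiEntropy {n : Type*} [Fintype n] [DecidableEq n] (f : ℝ → ℝ) (A ρ₁ ρ₂ : Matrix n n ℂ) :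
    ℂ :=
  hsInner (A * CFC.sqrt ρ₂) (hsFunctionalCalculus f (relModular ρ₁ ρ₂) (A * CFC.sqrt ρ₂))

end

/-!
By the Schwarz inequality, `V : B α*(ρ₂)^{1/2} ↦ α(B) ρ₂^{1/2}` is a contraction for the
Hilbert-Schmidt norms, and the same inequality for adjoints gives
`V* Δ(ρ₁/ρ₂) V ≤ Δ(α*(ρ₁)/α*(ρ₂))`. For `f` operator monotone with `f(0) ≥ 0`, Hansen's inequality
`V* f(X) V ≤ f(V* X V)` and monotonicity then yield `V* f(Δ(ρ₁/ρ₂)) V ≤ f(Δ(α*(ρ₁)/α*(ρ₂)))`, whose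
quadratic forms at `A α*(ρ₂)^{1/2}` are the two quasi-entropies.

For Hansen's inequality, dilate `V` to an isometry `K`, with `X` extended by `0`. Splitting along
the range of `K` bounds `X` by `(1 + t) K K* X K K*` plus a multiple of its compression to the
orthogonal complement; that bound commutes with `K K*`, so `f` acts on its blocks separately.
-/

open Matrix

section LoewnerOrder

variable {𝕜 ι κ : Type*} [RCLike 𝕜] [Fintype ι]

theorem conjTranspose_mul_mul_mono {X Y : Matrix ι ι 𝕜} [Finite κ] (h : X ≤ Y)
    (V : Matrix ι κ 𝕜) : Vᴴ * X * V ≤ Vᴴ * Y * V := by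
  have := (Matrix.le_iff.1 h).conjTranspose_mul_mul_same V
  rwa [Matrix.mul_sub, Matrix.sub_mul, ← Matrix.le_iff] at this

theorem nonneg_iff_forall_dotProduct_mulVec_nonneg {X : Matrix ι ι ℂ} :
    0 ≤ X ↔ ∀ x : ι → ℂ, 0 ≤ star x ⬝ᵥ X *ᵥ x := by
  classical
  refine ⟨fun h => (nonneg_iff_posSemidef.1 h).dotProduct_mulVec_nonneg, fun h => ?_⟩
  rw [nonneg_iff_posSemidef, ← isPositive_toEuclideanLin_iff, LinearMap.isPositive_iff_complex]
  intro x
  rw [EuclideanSpace.inner_eq_star_dotProduct, ofLp_toLpLin, toLin'_apply, dotProduct_star]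
  have hx : 0 ≤ star (X *ᵥ x.ofLp ⬝ᵥ star x.ofLp) := by
    rw [star_nonneg_iff, dotProduct_comm]
    exact h x.ofLp
  exact ⟨Complex.ext rfl (Complex.nonneg_iff.1 hx).2, (Complex.nonneg_iff.1 hx).1⟩

theorem add_conjTranspose_mul_mul_add_le {X : Matrix ι ι 𝕜} [Finite κ] (hX : 0 ≤ X)
    (A B : Matrix ι κ 𝕜) {t : ℝ} (ht : 0 < t) :
    (A + B)ᴴ * X * (A + B) ≤ (1 + t) • (Aᴴ * X * A) + (1 + t⁻¹) • (Bᴴ * X * B) := by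
  have hsq : 0 ≤ t⁻¹ • ((t • A - B)ᴴ * X * (t • A - B)) :=
    (hX.posSemidef.conjTranspose_mul_mul_same _).smul (inv_pos.2 ht).le |>.nonneg
  rw [← sub_nonneg]
  convert hsq using 1
  simp only [conjTranspose_add, conjTranspose_sub, conjTranspose_smul, star_trivial,
    Matrix.add_mul, Matrix.mul_add, Matrix.sub_mul, Matrix.mul_sub, Matrix.smul_mul,
    Matrix.mul_smul, smul_sub, smul_smul]
  match_scalars <;> field_simp <;> ring

theorem le_of_forall_pos_le_one_add_smul {ι : Type*} [Finite ι] {X Y : Matrix ι ι ℂ}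
    (h : ∀ t : ℝ, 0 < t → X ≤ (1 + t) • Y) : X ≤ Y := by
  classical
  have := Fintype.ofFinite ι
  open scoped Matrix.Norms.L2Operator in
  have hlim : Filter.Tendsto (fun t : ℝ => (1 + t) • Y) (nhdsWithin 0 (Set.Ioi 0)) (nhds Y) := by
    have : Continuous fun t : ℝ => (1 + t) • Y := by fun_prop
    simpa using (this.tendsto 0).mono_left nhdsWithin_le_nhds
  open scoped Matrix.Norms.L2Operator in
  exact ge_of_tendsto hlim (Filter.eventually_of_mem self_mem_nhdsWithin h)

end LoewnerOrder

section FunctionalCalculus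

variable {𝕜 ι κ : Type*} [RCLike 𝕜] [Fintype ι] [DecidableEq ι] [Fintype κ] [DecidableEq κ]

theorem cfc_eq_aeval_interpolate (f : ℝ → ℝ) {X : Matrix ι ι 𝕜} (hX : X.IsHermitian)
    {s : Finset ℝ} (hs : spectrum ℝ X ⊆ s) :
    cfc f X = Polynomial.aeval X (Lagrange.interpolate s id f) := by
  rw [← cfc_polynomial _ X hX]
  exact cfc_congr fun x hx =>
    (Lagrange.eval_interpolate_at_node (v := id) f Function.injective_id.injOn (hs hx)).symm

theorem aeval_mul_eq_mul_aeval {R A : Type*} [CommSemiring R] [Semiring A] [Algebra R A]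
    {X : Matrix ι ι A} {Y : Matrix κ κ A} {J : Matrix ι κ A} (h : X * J = J * Y)
    (p : Polynomial R) : Polynomial.aeval X p * J = J * Polynomial.aeval Y p := by
  have hpow (k : ℕ) : X ^ k * J = J * Y ^ k := by
    induction k with
    | zero => simp
    | succ k ih =>
      rw [pow_succ, Matrix.mul_assoc, h, ← Matrix.mul_assoc, ih, Matrix.mul_assoc, ← pow_succ]
  simp only [Polynomial.aeval_eq_sum_range, Matrix.sum_mul, Matrix.mul_sum, Matrix.smul_mul,
    Matrix.mul_smul, hpow]

theorem cfc_mul_eq_mul_cfc (f : ℝ → ℝ) {X : Matrix ι ι 𝕜} {Y : Matrix κ κ 𝕜}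
    {J : Matrix ι κ 𝕜} (hX : X.IsHermitian) (hY : Y.IsHermitian) (h : X * J = J * Y) :
    cfc f X * J = J * cfc f Y := by
  let s := (finite_real_spectrum (A := X)).toFinset ∪ (finite_real_spectrum (A := Y)).toFinset
  rw [cfc_eq_aeval_interpolate f hX (s := s) (by simp [s]),
    cfc_eq_aeval_interpolate f hY (s := s) (by simp [s]), aeval_mul_eq_mul_aeval h]

theorem cfc_fromBlocks_zero_zero (f : ℝ → ℝ) {X : Matrix ι ι 𝕜} {Y : Matrix κ κ 𝕜}
    (hX : X.IsHermitian) (hY : Y.IsHermitian) :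
    cfc f (fromBlocks X 0 0 Y) = fromBlocks (cfc f X) 0 0 (cfc f Y) := by
  have hXY : (fromBlocks X 0 0 Y).IsHermitian := hX.fromBlocks (by simp) hY
  let J : Matrix (ι ⊕ κ) ι 𝕜 := fromRows 1 0
  let K : Matrix (ι ⊕ κ) κ 𝕜 := fromRows 0 1
  have hJ : cfc f (fromBlocks X 0 0 Y) * J = J * cfc f X :=
    cfc_mul_eq_mul_cfc f hXY hX (by simp [J, fromBlocks_mul_fromRows, fromRows_mul])
  have hK : cfc f (fromBlocks X 0 0 Y) * K = K * cfc f Y :=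
    cfc_mul_eq_mul_cfc f hXY hY (by simp [K, fromBlocks_mul_fromRows, fromRows_mul])
  calc cfc f (fromBlocks X 0 0 Y)
      = cfc f (fromBlocks X 0 0 Y) * fromCols J K := by
        rw [fromCols_fromRows_eq_fromBlocks, fromBlocks_one, Matrix.mul_one]
    _ = fromCols (J * cfc f X) (K * cfc f Y) := by rw [mul_fromCols, hJ, hK]
    _ = fromBlocks (cfc f X) 0 0 (cfc f Y) := by
        rw [fromRows_mul, fromRows_mul, fromCols_fromRows_eq_fromBlocks, Matrix.one_mul,
          Matrix.one_mul, Matrix.zero_mul, Matrix.zero_mul]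

end FunctionalCalculus

namespace OperatorMonotone

variable {ι κ : Type*} [Fintype ι] [DecidableEq ι] [Fintype κ] [DecidableEq κ] {f : ℝ → ℝ}

theorem cfc_le_cfc (hf : OperatorMonotone f) {X Y : Matrix ι ι ℂ} (hX : 0 ≤ X) (hXY : X ≤ Y) :
    cfc f X ≤ cfc f Y := by
  let e := Fintype.equivFin ι
  let J : Matrix (Fin (Fintype.card ι)) ι ℂ := (1 : Matrix ι ι ℂ).submatrix e.symm id
  have hJ : Jᴴ * J = 1 := by
    simp [J, conjTranspose_submatrix, submatrix_mul_equiv]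
  have hcfc {Z : Matrix ι ι ℂ} (hZ : 0 ≤ Z) : Jᴴ * cfc f (J * Z * Jᴴ) * J = cfc f Z := by
    have hZ' : Z.IsHermitian := (nonneg_iff_posSemidef.1 hZ).isHermitian
    rw [Matrix.mul_assoc, cfc_mul_eq_mul_cfc f (isHermitian_mul_mul_conjTranspose J hZ') hZ'
      (by rw [Matrix.mul_assoc, hJ, Matrix.mul_one]), ← Matrix.mul_assoc, hJ, Matrix.one_mul]
  rw [← hcfc hX, ← hcfc (hX.trans hXY)]
  refine conjTranspose_mul_mul_mono (hf _ _ _ ?_ ?_) J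
  · simpa using conjTranspose_mul_mul_mono hX Jᴴ
  · simpa using conjTranspose_mul_mul_mono hXY Jᴴ

theorem conjTranspose_mul_cfc_mul_le_of_isometry (hf : OperatorMonotone f) {X : Matrix ι ι ℂ}
    (hX : 0 ≤ X) {K : Matrix ι κ ℂ} (hK : Kᴴ * K = 1) {t : ℝ} (ht : 0 < t) :
    Kᴴ * cfc f X * K ≤ cfc f ((1 + t) • (Kᴴ * X * K)) := by
  set Q := 1 - K * Kᴴ with hQ
  have hQH : Qᴴ = Q := (isHermitian_one.sub (isHermitian_mul_conjTranspose_self K)).eq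
  have hQK : Q * K = 0 := by
    rw [hQ, Matrix.sub_mul, Matrix.mul_assoc, hK, Matrix.mul_one, Matrix.one_mul, sub_self]
  set Z := (1 + t) • (Kᴴ * X * K) with hZ
  set Y := K * Z * Kᴴ + (1 + t⁻¹) • (Q * X * Q) with hY
  have hXY : X ≤ Y := by
    have h := add_conjTranspose_mul_mul_add_le hX (K * Kᴴ) Q ht
    simpa [hY, hZ, hQ ▸ hQH, hQ, Matrix.mul_assoc] using h
  have hYK : Y * K = K * Z := by
    simp [hY, Matrix.add_mul, Matrix.mul_assoc, hQK, hK]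
  have hYH : Y.IsHermitian := (nonneg_iff_posSemidef.1 (hX.trans hXY)).isHermitian
  have hZH : Z.IsHermitian := by
    have hXH := (nonneg_iff_posSemidef.1 hX).isHermitian
    exact (isHermitian_conjTranspose_mul_mul K hXH).smul (IsSelfAdjoint.all _)
  calc Kᴴ * cfc f X * K ≤ Kᴴ * cfc f Y * K :=
        conjTranspose_mul_mul_mono (hf.cfc_le_cfc hX hXY) K
    _ = cfc f Z := by
        rw [Matrix.mul_assoc, cfc_mul_eq_mul_cfc f hYH hZH hYK, ← Matrix.mul_assoc, hK,
          Matrix.one_mul]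

theorem conjTranspose_mul_cfc_mul_le_cfc_smul (hf : OperatorMonotone f) (hf0 : 0 ≤ f 0)
    {X : Matrix ι ι ℂ} (hX : 0 ≤ X) {V : Matrix ι κ ℂ} (hV : Vᴴ * V ≤ 1) {t : ℝ} (ht : 0 < t) :
    Vᴴ * cfc f X * V ≤ cfc f ((1 + t) • (Vᴴ * X * V)) := by
  obtain ⟨W, hW⟩ := CStarAlgebra.nonneg_iff_eq_star_mul_self.1 (sub_nonneg.2 hV)
  set K : Matrix (ι ⊕ κ) κ ℂ := fromRows V W with hK
  have hblock (A : Matrix ι ι ℂ) (B : Matrix κ κ ℂ) :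
      Kᴴ * fromBlocks A 0 0 B * K = Vᴴ * A * V + Wᴴ * B * W := by
    simp [hK, conjTranspose_fromRows_eq_fromCols_conjTranspose, fromCols_mul_fromBlocks,
      fromCols_mul_fromRows]
  have hisometry : Kᴴ * K = 1 := by
    rw [← Matrix.mul_one Kᴴ, ← fromBlocks_one, hblock, Matrix.mul_one, Matrix.mul_one,
      ← star_eq_conjTranspose W, ← hW, add_sub_cancel]
  have hX0 : 0 ≤ fromBlocks X 0 0 (0 : Matrix κ κ ℂ) := by
    let P : Matrix ι (ι ⊕ κ) ℂ := fromCols 1 0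
    have hcompress : fromBlocks X 0 0 (0 : Matrix κ κ ℂ) = Pᴴ * X * P := by
      rw [conjTranspose_fromCols_eq_fromRows_conjTranspose, fromRows_mul, fromRows_mul_fromCols]
      simp
    rw [hcompress]
    simpa only [Matrix.mul_zero, Matrix.zero_mul] using conjTranspose_mul_mul_mono hX P
  have hf0W : 0 ≤ Wᴴ * cfc f (0 : Matrix κ κ ℂ) * W := by
    have h0 : 0 ≤ cfc f (0 : Matrix κ κ ℂ) := by
      rw [cfc_apply_zero]
      exact algebraMap_nonneg _ hf0
    simpa using conjTranspose_mul_mul_mono h0 W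
  calc Vᴴ * cfc f X * V
      ≤ Vᴴ * cfc f X * V + Wᴴ * cfc f (0 : Matrix κ κ ℂ) * W := le_add_of_nonneg_right hf0W
    _ = Kᴴ * cfc f (fromBlocks X 0 0 (0 : Matrix κ κ ℂ)) * K := by
        rw [cfc_fromBlocks_zero_zero f (nonneg_iff_posSemidef.1 hX).isHermitian isHermitian_zero,
          hblock]
    _ ≤ cfc f ((1 + t) • (Kᴴ * fromBlocks X 0 0 (0 : Matrix κ κ ℂ) * K)) :=
        hf.conjTranspose_mul_cfc_mul_le_of_isometry hX0 hisometry ht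
    _ = cfc f ((1 + t) • (Vᴴ * X * V)) := by simp [hblock]

/-- Hansen's inequality. -/
theorem conjTranspose_mul_cfc_mul_le (hf : OperatorMonotone f) (hf0 : 0 ≤ f 0)
    {X : Matrix ι ι ℂ} (hX : 0 ≤ X) {V : Matrix ι κ ℂ} (hV : Vᴴ * V ≤ 1) :
    Vᴴ * cfc f X * V ≤ cfc f (Vᴴ * X * V) := by
  refine le_of_forall_pos_le_one_add_smul fun t ht => ?_
  -- Shrinking `V` by `s` with `s ^ 2 * (1 + t) = 1` absorbs the factor inside `f`.
  set s : ℝ := (√(1 + t))⁻¹ with hs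
  have hs2 : (1 + t) * (s * s) = 1 := by
    rw [hs, ← mul_inv, Real.mul_self_sqrt (by positivity), mul_inv_cancel₀ (by positivity)]
  have hconj (A : Matrix ι ι ℂ) : (s • V)ᴴ * A * (s • V) = (s * s) • (Vᴴ * A * V) := by
    simp [smul_smul]
  have hsV : (s • V)ᴴ * (s • V) ≤ 1 := by
    have hs1 : s * s ≤ 1 := by nlinarith
    calc (s • V)ᴴ * (s • V) = (s * s) • (Vᴴ * V) := by simpa using hconj 1
      _ ≤ (s * s) • 1 := smul_le_smul_of_nonneg_left hV (mul_self_nonneg s)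
      _ ≤ 1 := smul_le_of_le_one_left zero_le_one hs1
  have h := hf.conjTranspose_mul_cfc_mul_le_cfc_smul hf0 hX hsV ht
  rw [hconj, hconj, smul_smul, hs2, one_smul] at h
  calc Vᴴ * cfc f X * V = (1 + t) • (s * s) • (Vᴴ * cfc f X * V) := by
        rw [smul_smul, hs2, one_smul]
    _ ≤ (1 + t) • cfc f (Vᴴ * X * V) := smul_le_smul_of_nonneg_left h (by positivity)

end OperatorMonotone

section HilbertSchmidt

variable {n : Type*} [Fintype n]

theorem hsInner_mul_left (X B C : Matrix n n ℂ) : hsInner (X * B) C = hsInner B (Xᴴ * C) := by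
  rw [hsInner, hsInner, conjTranspose_mul, Matrix.mul_assoc]

theorem hsInner_mul_right (B Y C : Matrix n n ℂ) : hsInner (B * Y) C = hsInner B (C * Yᴴ) := by
  rw [hsInner, hsInner, conjTranspose_mul, Matrix.mul_assoc, trace_mul_comm, Matrix.mul_assoc]

theorem hsInner_self_nonneg (B : Matrix n n ℂ) : 0 ≤ hsInner B B :=
  (posSemidef_conjTranspose_mul_self B).trace_nonneg

theorem hsInner_self_eq_zero {B : Matrix n n ℂ} : hsInner B B = 0 ↔ B = 0 :=
  trace_conjTranspose_mul_self_eq_zero_iff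

theorem hsInner_mul_mul_nonneg {X Y : Matrix n n ℂ} (hX : 0 ≤ X) (hY : 0 ≤ Y)
    (B : Matrix n n ℂ) : 0 ≤ hsInner B (X * B * Y) := by
  classical
  obtain ⟨S, rfl⟩ := CStarAlgebra.nonneg_iff_eq_star_mul_self.1 hX
  obtain ⟨T, rfl⟩ := CStarAlgebra.nonneg_iff_eq_mul_star_self.1 hY
  have h : hsInner B (star S * S * B * (T * star T)) = hsInner (S * B * T) (S * B * T) := by
    rw [hsInner_mul_right, Matrix.mul_assoc S B, hsInner_mul_left]
    simp only [star_eq_conjTranspose, Matrix.mul_assoc]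
  rw [h]
  exact hsInner_self_nonneg _

theorem hsInner_mul_mul_mono_right {X Y Y' : Matrix n n ℂ} (hX : 0 ≤ X) (hY : Y ≤ Y')
    (B : Matrix n n ℂ) : hsInner B (X * B * Y) ≤ hsInner B (X * B * Y') := by
  have h := hsInner_mul_mul_nonneg hX (sub_nonneg.2 hY) B
  rwa [Matrix.mul_sub, hsInner, Matrix.mul_sub, trace_sub, sub_nonneg] at h

theorem hsInner_mono_left {X X' ρ : Matrix n n ℂ} (h : X ≤ X') (hρ : 0 ≤ ρ) :
    hsInner X ρ ≤ hsInner X' ρ := by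
  classical
  have hX : (X' - X)ᴴ = X' - X := (nonneg_iff_posSemidef.1 (sub_nonneg.2 h)).isHermitian
  have hnonneg : 0 ≤ hsInner (X' - X) ρ := by
    simpa [hsInner, hX, trace_mul_comm _ ρ] using hsInner_mul_mul_nonneg hρ (sub_nonneg.2 h) 1
  rwa [hsInner, conjTranspose_sub, Matrix.sub_mul, trace_sub, sub_nonneg] at hnonneg

theorem stdBasis_repr_apply (B : Matrix n n ℂ) (p : n × n) :
    (stdBasis ℂ n n).repr B p = B p.1 p.2 := by
  simp [stdBasis]

theorem star_stdBasis_repr_dotProduct (B C : Matrix n n ℂ) :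
    star ((stdBasis ℂ n n).repr B : n × n → ℂ) ⬝ᵥ (stdBasis ℂ n n).repr C = hsInner B C := by
  simp only [dotProduct, Pi.star_apply, stdBasis_repr_apply, hsInner, trace, diag_apply,
    mul_apply, conjTranspose_apply, Fintype.sum_prod_type]
  exact Finset.sum_comm

variable [DecidableEq n]

theorem sqrt_isHermitian (ρ : Matrix n n ℂ) : (CFC.sqrt ρ).IsHermitian :=
  (nonneg_iff_posSemidef.1 (CFC.sqrt_nonneg ρ)).isHermitian

theorem hsInner_mul_sqrt_self {ρ : Matrix n n ℂ} (hρ : 0 ≤ ρ)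
    (B : Matrix n n ℂ) :
    hsInner (B * CFC.sqrt ρ) (B * CFC.sqrt ρ) = hsInner B (B * ρ) := by
  rw [hsInner_mul_right, (sqrt_isHermitian ρ).eq, Matrix.mul_assoc, CFC.sqrt_mul_sqrt_self ρ hρ]

end HilbertSchmidt

section MatrixOfMap

variable {k m n : Type*} [Fintype k] [DecidableEq k] [Fintype m] [DecidableEq m] [Fintype n]

/-- The matrix of a linear map between matrix algebras in the bases of matrix units. These bases
are orthonormal for the Hilbert-Schmidt inner products, so that `hsDual` becomes the conjugate
transpose and positivity of a map becomes positivity of its matrix. -/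
noncomputable def hsMatrix (T : Matrix m m ℂ →ₗ[ℂ] Matrix n n ℂ) : Matrix (n × n) (m × m) ℂ :=
  LinearMap.toMatrix (stdBasis ℂ m m) (stdBasis ℂ n n) T

theorem hsMatrix_comp (S : Matrix m m ℂ →ₗ[ℂ] Matrix n n ℂ)
    (T : Matrix k k ℂ →ₗ[ℂ] Matrix m m ℂ) : hsMatrix (S ∘ₗ T) = hsMatrix S * hsMatrix T :=
  LinearMap.toMatrix_comp _ _ _ S T

variable [DecidableEq n]

theorem hsMatrix_hsFunctionalCalculus (f : ℝ → ℝ) (T : Matrix n n ℂ →ₗ[ℂ] Matrix n n ℂ) :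
    hsMatrix (hsFunctionalCalculus f T) = cfc f (hsMatrix T) :=
  LinearMap.toMatrix_toLin _ _ _

theorem star_dotProduct_hsMatrix_mulVec (T : Matrix n n ℂ →ₗ[ℂ] Matrix n n ℂ)
    (B C : Matrix n n ℂ) : star ((stdBasis ℂ n n).repr B : n × n → ℂ) ⬝ᵥ
      hsMatrix T *ᵥ (stdBasis ℂ n n).repr C = hsInner B (T C) := by
  rw [hsMatrix, LinearMap.toMatrix_mulVec_repr, star_stdBasis_repr_dotProduct]

theorem hsMatrix_hsDual (T : Matrix m m ℂ →ₗ[ℂ] Matrix n n ℂ) :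
    hsMatrix (hsDual T) = (hsMatrix T)ᴴ := by
  ext p q
  have h := hsInner_hsDual T (single p.1 p.2 1) (single q.1 q.2 1)
  rw [conjTranspose_apply, hsMatrix, hsMatrix, LinearMap.toMatrix_apply, LinearMap.toMatrix_apply,
    stdBasis_repr_apply, stdBasis_repr_apply, stdBasis_eq_single, stdBasis_eq_single]
  simpa [hsInner, trace_single_mul, trace_mul_single] using h

theorem hsMatrix_nonneg_iff {T : Matrix n n ℂ →ₗ[ℂ] Matrix n n ℂ} :
    0 ≤ hsMatrix T ↔ ∀ B, 0 ≤ hsInner B (T B) := by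
  rw [nonneg_iff_forall_dotProduct_mulVec_nonneg]
  simp only [← star_dotProduct_hsMatrix_mulVec]
  exact (stdBasis ℂ n n).equivFun.surjective.forall

theorem hsMatrix_le_iff {S T : Matrix n n ℂ →ₗ[ℂ] Matrix n n ℂ} :
    hsMatrix S ≤ hsMatrix T ↔ ∀ B, hsInner B (S B) ≤ hsInner B (T B) := by
  rw [← sub_nonneg, hsMatrix, hsMatrix, ← map_sub, ← hsMatrix, hsMatrix_nonneg_iff]
  simp only [LinearMap.sub_apply, hsInner, Matrix.mul_sub, trace_sub, sub_nonneg]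

theorem OperatorMonotone.hsInner_hsFunctionalCalculus_le {f : ℝ → ℝ} (hf : OperatorMonotone f)
    (hf0 : 0 ≤ f 0) {V : Matrix m m ℂ →ₗ[ℂ] Matrix n n ℂ} {S : Matrix n n ℂ →ₗ[ℂ] Matrix n n ℂ}
    {T : Matrix m m ℂ →ₗ[ℂ] Matrix m m ℂ} (hV : ∀ B, hsInner (V B) (V B) ≤ hsInner B B)
    (hS : ∀ B, 0 ≤ hsInner B (S B)) (hST : ∀ B, hsInner (V B) (S (V B)) ≤ hsInner B (T B))
    (B : Matrix m m ℂ) :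
    hsInner (V B) (hsFunctionalCalculus f S (V B)) ≤ hsInner B (hsFunctionalCalculus f T B) := by
  have hcompress (R : Matrix n n ℂ →ₗ[ℂ] Matrix n n ℂ) :
      (hsMatrix V)ᴴ * hsMatrix R * hsMatrix V = hsMatrix (hsDual V ∘ₗ R ∘ₗ V) := by
    rw [hsMatrix_comp, hsMatrix_comp, hsMatrix_hsDual, Matrix.mul_assoc]
  have hV' : (hsMatrix V)ᴴ * hsMatrix V ≤ 1 := by
    rw [← hsMatrix_hsDual, ← hsMatrix_comp, ← LinearMap.toMatrix_id (stdBasis ℂ m m), ← hsMatrix,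
      hsMatrix_le_iff]
    simpa [hsInner_hsDual] using hV
  have hS' : 0 ≤ hsMatrix S := hsMatrix_nonneg_iff.2 hS
  have hVS : 0 ≤ (hsMatrix V)ᴴ * hsMatrix S * hsMatrix V := by
    simpa using conjTranspose_mul_mul_mono hS' (hsMatrix V)
  have hVST : (hsMatrix V)ᴴ * hsMatrix S * hsMatrix V ≤ hsMatrix T := by
    rw [hcompress, hsMatrix_le_iff]
    simpa [hsInner_hsDual] using hST
  have h : hsMatrix (hsDual V ∘ₗ hsFunctionalCalculus f S ∘ₗ V) ≤
      hsMatrix (hsFunctionalCalculus f T) :=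
    calc hsMatrix (hsDual V ∘ₗ hsFunctionalCalculus f S ∘ₗ V)
        = (hsMatrix V)ᴴ * cfc f (hsMatrix S) * hsMatrix V := by
          rw [← hcompress, hsMatrix_hsFunctionalCalculus]
      _ ≤ cfc f ((hsMatrix V)ᴴ * hsMatrix S * hsMatrix V) :=
          hf.conjTranspose_mul_cfc_mul_le hf0 hS' hV'
      _ ≤ cfc f (hsMatrix T) := hf.cfc_le_cfc hVS hVST
      _ = hsMatrix (hsFunctionalCalculus f T) := (hsMatrix_hsFunctionalCalculus f T).symm
  simpa [hsInner_hsDual] using hsMatrix_le_iff.1 h B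

end MatrixOfMap

section SupportInv

variable {n : Type*} [Fintype n] [DecidableEq n] {X : Matrix n n ℂ}

theorem supportInv_isHermitian (X : Matrix n n ℂ) : (supportInv X).IsHermitian :=
  (cfc_predicate _ X : IsSelfAdjoint _)

theorem supportInv_nonneg (hX : 0 ≤ X) : 0 ≤ supportInv X :=
  cfc_nonneg fun _ hx => inv_nonneg.2 (spectrum_nonneg_of_nonneg hX hx)

theorem mul_supportInv_eq_cfc (hX : X.IsHermitian) :
    X * supportInv X = cfc (fun x : ℝ => x * x⁻¹) X := by
  rw [cfc_mul (fun x => x) (fun x => x⁻¹) X continuousOn_id (finite_real_spectrum.continuousOn _),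
    cfc_id' ℝ X, supportInv]

theorem mul_supportInv_le_one (hX : X.IsHermitian) : X * supportInv X ≤ 1 := by
  rw [mul_supportInv_eq_cfc hX]
  exact cfc_le_one _ X fun x _ => mul_inv_le_one

theorem mul_supportInv_mul_self (hX : X.IsHermitian) : X * supportInv X * X = X := by
  have h := cfc_mul (fun x : ℝ => x * x⁻¹) (fun x => x) X (finite_real_spectrum.continuousOn _)
    continuousOn_id
  simp only [mul_inv_mul_cancel] at h
  rwa [cfc_id' ℝ X, ← mul_supportInv_eq_cfc hX, eq_comm] at h

theorem supportInv_mul_comm (hX : X.IsHermitian) : supportInv X * X = X * supportInv X :=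
  cfc_mul_eq_mul_cfc _ hX hX rfl

theorem supportInv_mul_self (hX : X.IsHermitian) :
    supportInv (X * X) = supportInv X * supportInv X := by
  have hsq : cfc (fun x : ℝ => x * x) X = X * X := by
    rw [cfc_mul (fun x => x) (fun x => x) X, cfc_id' ℝ X]
  rw [supportInv, supportInv, ← hsq,
    ← cfc_comp' _ _ X ((finite_real_spectrum.image _).continuousOn _),
    ← cfc_mul _ _ X (finite_real_spectrum.continuousOn _) (finite_real_spectrum.continuousOn _)]
  simp only [mul_inv]

theorem supportInv_mul_mul_supportInv_le_one (hX : X.IsHermitian) :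
    supportInv X * (X * X) * supportInv X ≤ 1 := by
  calc supportInv X * (X * X) * supportInv X = X * supportInv X * X * supportInv X := by
        rw [← Matrix.mul_assoc, supportInv_mul_comm hX]
    _ = X * supportInv X := by rw [mul_supportInv_mul_self hX]
    _ ≤ 1 := mul_supportInv_le_one hX

theorem mul_supportInv_mul_self_mul_le_one (hX : X.IsHermitian) :
    X * supportInv (X * X) * X ≤ 1 := by
  calc X * supportInv (X * X) * X = X * supportInv X * X * supportInv X := by
        rw [supportInv_mul_self hX, Matrix.mul_assoc, Matrix.mul_assoc, supportInv_mul_comm hX]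
        simp only [Matrix.mul_assoc]
    _ = X * supportInv X := by rw [mul_supportInv_mul_self hX]
    _ ≤ 1 := mul_supportInv_le_one hX

theorem hsInner_relModular_nonneg {ρ₁ ρ₂ : Matrix n n ℂ} (h₁ : 0 ≤ ρ₁) (h₂ : 0 ≤ ρ₂)
    (B : Matrix n n ℂ) : 0 ≤ hsInner B (relModular ρ₁ ρ₂ B) := by
  simpa [relModular, Matrix.mul_assoc] using hsInner_mul_mul_nonneg h₁ (supportInv_nonneg h₂) B

end SupportInv

section SchwarzMap

variable {m n : Type*} [Fintype m] [Fintype n] {α : Matrix m m ℂ →ₗ[ℂ] Matrix n n ℂ}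

theorem IsSchwarzMap.map_nonneg (hα : IsSchwarzMap α) {X : Matrix m m ℂ} (hX : 0 ≤ X) :
    0 ≤ α X := by
  classical
  obtain ⟨B, rfl⟩ := CStarAlgebra.nonneg_iff_eq_star_mul_self.1 hX
  exact (posSemidef_conjTranspose_mul_self (α B)).nonneg.trans (hα B)

variable [DecidableEq m]

theorem hsDual_nonneg (hα : ∀ X, 0 ≤ X → 0 ≤ α X) {ρ : Matrix n n ℂ} (hρ : 0 ≤ ρ) :
    0 ≤ hsDual α ρ := by
  rw [nonneg_iff_forall_dotProduct_mulVec_nonneg]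
  intro x
  have hx : 0 ≤ vecMulVec x (star x) := (posSemidef_vecMulVec_self_star x).nonneg
  have hform : star x ⬝ᵥ hsDual α ρ *ᵥ x = hsInner (vecMulVec x (star x)) (hsDual α ρ) := by
    rw [hsInner, conjTranspose_vecMulVec, star_star, vecMulVec_mul, trace_vecMulVec,
      dotProduct_mulVec, dotProduct_comm]
  have hzero : hsInner 0 ρ = 0 := by rw [hsInner, conjTranspose_zero, Matrix.zero_mul, trace_zero]
  rw [hform, hsInner_hsDual, ← hzero]
  exact hsInner_mono_left (hα _ hx) hρ

namespace IsSchwarzMap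

theorem hsInner_map_mul_le (hα : IsSchwarzMap α) {ρ : Matrix n n ℂ} (hρ : 0 ≤ ρ)
    (B : Matrix m m ℂ) : hsInner (α B) (α B * ρ) ≤ hsInner B (B * hsDual α ρ) := by
  calc hsInner (α B) (α B * ρ) = hsInner ((α B)ᴴ * α B) ρ := by
        rw [hsInner_mul_left, conjTranspose_conjTranspose]
    _ ≤ hsInner (α (Bᴴ * B)) ρ := hsInner_mono_left (hα B) hρ
    _ = hsInner B (B * hsDual α ρ) := by
        rw [← hsInner_hsDual, hsInner_mul_left, conjTranspose_conjTranspose]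

theorem hsInner_mul_map_le (hα : IsSchwarzMap α) {ρ : Matrix n n ℂ} (hρ : 0 ≤ ρ)
    (B : Matrix m m ℂ) : hsInner (α B) (ρ * α B) ≤ hsInner B (hsDual α ρ * B) := by
  have hSchwarz : α B * (α B)ᴴ ≤ α (B * Bᴴ) := by
    simpa [hα.map_conjTranspose] using hα Bᴴ
  calc hsInner (α B) (ρ * α B) = hsInner (α B * (α B)ᴴ) ρ := by
        rw [hsInner_mul_right, conjTranspose_conjTranspose]
    _ ≤ hsInner (α (B * Bᴴ)) ρ := hsInner_mono_left hSchwarz hρ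
    _ = hsInner B (hsDual α ρ * B) := by
        rw [← hsInner_hsDual, hsInner_mul_right, conjTranspose_conjTranspose]

end IsSchwarzMap

end SchwarzMap

section TransferMap

variable {m n : Type*} [Fintype m] [DecidableEq m] [Fintype n] [DecidableEq n]
  {α : Matrix m m ℂ →ₗ[ℂ] Matrix n n ℂ} {ρ ρ₁ ρ₂ : Matrix n n ℂ}

/-- The contraction `B α*(ρ)^{1/2} ↦ α(B) ρ^{1/2}` between the standard representations of `α*(ρ)`
and `ρ`, through which the two quasi-entropies are compared. It is made total by sending the
matrices that vanish on the support of `α*(ρ)` to `0`. -/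
noncomputable def transferMap (α : Matrix m m ℂ →ₗ[ℂ] Matrix n n ℂ) (ρ : Matrix n n ℂ) :
    Matrix m m ℂ →ₗ[ℂ] Matrix n n ℂ :=
  LinearMap.mulRight ℂ (CFC.sqrt ρ) ∘ₗ α ∘ₗ
    LinearMap.mulRight ℂ (supportInv (CFC.sqrt (hsDual α ρ)))

theorem transferMap_apply (B : Matrix m m ℂ) :
    transferMap α ρ B = α (B * supportInv (CFC.sqrt (hsDual α ρ))) * CFC.sqrt ρ :=
  rfl

namespace IsSchwarzMap

theorem hsInner_transferMap_self_le (hα : IsSchwarzMap α) (hρ : 0 ≤ ρ) (B : Matrix m m ℂ) :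
    hsInner (transferMap α ρ B) (transferMap α ρ B) ≤ hsInner B B := by
  have hσ : 0 ≤ hsDual α ρ := hsDual_nonneg (fun _ => hα.map_nonneg) hρ
  have hle := supportInv_mul_mul_supportInv_le_one (sqrt_isHermitian (hsDual α ρ))
  rw [CFC.sqrt_mul_sqrt_self _ hσ] at hle
  set s := supportInv (CFC.sqrt (hsDual α ρ))
  have hsH : sᴴ = s := supportInv_isHermitian _
  calc hsInner (transferMap α ρ B) (transferMap α ρ B)
      = hsInner (α (B * s)) (α (B * s) * ρ) := by rw [transferMap_apply, hsInner_mul_sqrt_self hρ]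
    _ ≤ hsInner (B * s) (B * s * hsDual α ρ) := hα.hsInner_map_mul_le hρ _
    _ = hsInner B (1 * B * (s * hsDual α ρ * s)) := by
        rw [hsInner_mul_right, hsH, Matrix.one_mul]
        simp only [Matrix.mul_assoc]
    _ ≤ hsInner B (1 * B * 1) := hsInner_mul_mul_mono_right PosSemidef.one.nonneg hle B
    _ = hsInner B B := by rw [Matrix.one_mul, Matrix.mul_one]

theorem hsInner_transferMap_relModular_le (hα : IsSchwarzMap α) (h₁ : 0 ≤ ρ₁) (h₂ : 0 ≤ ρ₂)
    (B : Matrix m m ℂ) :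
    hsInner (transferMap α ρ₂ B) (relModular ρ₁ ρ₂ (transferMap α ρ₂ B)) ≤
      hsInner B (relModular (hsDual α ρ₁) (hsDual α ρ₂) B) := by
  have hσ : 0 ≤ hsDual α ρ₂ := hsDual_nonneg (fun _ => hα.map_nonneg) h₂
  have hle := mul_supportInv_mul_self_mul_le_one (sqrt_isHermitian ρ₂)
  have hsq := supportInv_mul_self (sqrt_isHermitian (hsDual α ρ₂))
  rw [CFC.sqrt_mul_sqrt_self _ h₂] at hle
  rw [CFC.sqrt_mul_sqrt_self _ hσ] at hsq
  set s := supportInv (CFC.sqrt (hsDual α ρ₂)) with hs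
  have hsH : sᴴ = s := supportInv_isHermitian _
  set C := α (B * s) with hC
  calc hsInner (transferMap α ρ₂ B) (relModular ρ₁ ρ₂ (transferMap α ρ₂ B))
      = hsInner C (ρ₁ * C * (CFC.sqrt ρ₂ * supportInv ρ₂ * CFC.sqrt ρ₂)) := by
        rw [transferMap_apply, hsInner_mul_right, (sqrt_isHermitian ρ₂).eq]
        simp only [relModular, LinearMap.comp_apply, LinearMap.mulLeft_apply,
          LinearMap.mulRight_apply, Matrix.mul_assoc, hC, hs]
    _ ≤ hsInner C (ρ₁ * C * 1) := hsInner_mul_mul_mono_right h₁ hle C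
    _ = hsInner C (ρ₁ * C) := by rw [Matrix.mul_one]
    _ ≤ hsInner (B * s) (hsDual α ρ₁ * (B * s)) := hα.hsInner_mul_map_le h₁ _
    _ = hsInner B (relModular (hsDual α ρ₁) (hsDual α ρ₂) B) := by
        rw [hsInner_mul_right, hsH]
        simp only [relModular, LinearMap.comp_apply, LinearMap.mulLeft_apply,
          LinearMap.mulRight_apply, Matrix.mul_assoc, hsq]

theorem transferMap_mul_sqrt (hα : IsSchwarzMap α) (hρ : 0 ≤ ρ) (A : Matrix m m ℂ) :
    transferMap α ρ (A * CFC.sqrt (hsDual α ρ)) = α A * CFC.sqrt ρ := by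
  have hσ : 0 ≤ hsDual α ρ := hsDual_nonneg (fun _ => hα.map_nonneg) hρ
  set τ := CFC.sqrt (hsDual α ρ) with hτ
  set D := A * τ * supportInv τ - A with hD
  -- `D` vanishes on the support of `α*(ρ)`, which by the Schwarz inequality forces `α(D)` to
  -- vanish on that of `ρ`.
  have hDσ : D * hsDual α ρ = 0 := by
    rw [← CFC.sqrt_mul_sqrt_self _ hσ, ← hτ, ← Matrix.mul_assoc, hD, Matrix.sub_mul,
      Matrix.mul_assoc A, Matrix.mul_assoc A, mul_supportInv_mul_self (sqrt_isHermitian _),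
      sub_self, Matrix.zero_mul]
  have hnorm : hsInner (α D * CFC.sqrt ρ) (α D * CFC.sqrt ρ) ≤ 0 := by
    calc hsInner (α D * CFC.sqrt ρ) (α D * CFC.sqrt ρ) = hsInner (α D) (α D * ρ) :=
          hsInner_mul_sqrt_self hρ _
      _ ≤ hsInner D (D * hsDual α ρ) := hα.hsInner_map_mul_le hρ D
      _ = 0 := by rw [hDσ, hsInner, Matrix.mul_zero, trace_zero]
  have hzero := hsInner_self_eq_zero.1 (hnorm.antisymm (hsInner_self_nonneg _))
  rwa [hD, map_sub, Matrix.sub_mul, sub_eq_zero] at hzero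

end IsSchwarzMap

end TransferMap

theorem mainTheorem3_general {m n : Type*} [Fintype m] [DecidableEq m] [Fintype n]
    [DecidableEq n] {f : ℝ → ℝ} (hf : OperatorMonotone f) (hf0 : 0 ≤ f 0)
    {α : Matrix m m ℂ →ₗ[ℂ] Matrix n n ℂ} (hα : IsSchwarzMap α) (A : Matrix m m ℂ)
    {ρ₁ ρ₂ : Matrix n n ℂ} (h₁ : 0 ≤ ρ₁) (h₂ : 0 ≤ ρ₂) :
    quasiEntropy f (α A) ρ₁ ρ₂ ≤ quasiEntropy f A (hsDual α ρ₁) (hsDual α ρ₂) := by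
  have h := hf.hsInner_hsFunctionalCalculus_le hf0 (hα.hsInner_transferMap_self_le h₂)
    (hsInner_relModular_nonneg h₁ h₂) (hα.hsInner_transferMap_relModular_le h₁ h₂)
    (A * CFC.sqrt (hsDual α ρ₂))
  rwa [hα.transferMap_mul_sqrt h₂] at h

theorem mainTheorem3 {m n : Type*} [Fintype m] [DecidableEq m] [Fintype n] [DecidableEq n]
    (f : ℝ → ℝ) (hf : OperatorMonotone f) (hf0 : 0 ≤ f 0)
    (α : Matrix m m ℂ →ₗ[ℂ] Matrix n n ℂ) (hα : IsSchwarzMap α) (hα1 : α 1 = 1)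
    (A : Matrix m m ℂ) (ρ₁ ρ₂ : Matrix n n ℂ)
    (hρ₁ : ρ₁.PosDef) (hρ₁_tr : ρ₁.trace = 1) (hρ₂ : ρ₂.PosDef) (hρ₂_tr : ρ₂.trace = 1) :
    quasiEntropy f (α A) ρ₁ ρ₂ ≤ quasiEntropy f A (hsDual α ρ₁) (hsDual α ρ₂) := by
  exact mainTheorem3_general hf hf0 hα A hρ₁.posSemidef.nonneg hρ₂.posSemidef.nonneg
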